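/- **Conventions.** Let $\Delta\subset\mathbb R^d$ be a lattice simplex of dimension $d$ with vertices $v_0,\dots,v_d\in\mathbb Z^d$. Its $\delta$-polynomial is $$\delta(\Delta,t)=(1-t)^{d+1}\sum_{n\ge 0}\#(n\Delta\cap\mathbb Z^d)\,t^n ,$$ and its associated finite abelian group is $$\Lambda_\Delta=\Big\{(\lambda_0,\dots,\lambda_d)\in(\mathbb R/\mathbb Z)^{d+1} : \sum_{i=0}^d\lambda_i(v_i,1)\in\mathbb Z^{d+1}\Big\}.$$ Two lattice polytopes $P,Q\subset\mathbb R^d$ are unimodularly equivalent if $Q=\{xU : x\in P\}+w$ for an integer matrix $U$ with $\det U=\pm1$ and some $w\in\mathbb Z^d$. The simplex $\Delta$ is a lattice pyramid over a lower-dimensional lattice simplex if $d\ge1$ and $\Delta$ is unimodularly equivalent to $\mathrm{conv}\big((\Delta'\times\{0\})\cup\{(0,\dots,0,1)\}\big)$ for some lattice simplex $\Delta'\subset\mathbb R^{d-1}$ of dimension $d-1$. **Statement.** Let $p$ be a prime, $\ell$ a positive integer and $k$ a nonnegative integer, and let $\Delta\subset\mathbb R^d$ be a lattice simplex of dimension $d$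 such that $\Lambda_\Delta$ is cyclic and $$\delta(\Delta,t)=1+t^{k+1}+t^{2(k+1)}+\cdots+t^{(p^\ell-1)(k+1)} .$$ Suppose that $\Delta$ is not a lattice pyramid over any lower-dimensional lattice simplex. Then there exist an integer $t\ge1$, integers $0<\ell_1<\cdots<\ell_t=\ell$ and positive integers $s_1,\dots,s_t$ such that, with $\ell_0=0$, $$s_i=\begin{cases}(p^{\ell-\ell_{i-1}}-p^{\ell-\ell_{i+1}})(k+1), & 1\le i\le t-1,\\ p^{\ell-\ell_{t-1}}(k+1), & i=t,\end{cases}$$ and, for some ordering of the vertices of $\Delta$, the group $\Lambda_\Delta$ is generated by $$\Big(\underbrace{1/p^{\ell_1},\dots,1/p^{\ell_1}}_{s_1},\underbrace{1/p^{\ell_2},\dots,1/p^{\ell_2}}_{s_2},\dots,\underbrace{1/p^{\ell_t},\dots,1/p^{\ell_t}}_{s_t}\Big)\in(\mathbb R/\mathbb Z)^{d+1}$$ (in particular $s_1+\cdots+s_t=d+1$). -/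

import Mathlib

noncomputable section

open scoped Pointwise

namespace GorensteinSimplex

/-- The real vector with the given integer coordinates. -/
def toReal {d : ℕ} (z : Fin d → ℤ) : Fin d → ℝ := fun j => (z j : ℝ)

/-- A lattice simplex of dimension `d` in `ℝ^d`, given by its `d + 1` affinely independent
lattice vertices. -/
structure LatticeSimplex (d : ℕ) where
  /-- The vertices `v_0, …, v_d`. -/
  vertex : Fin (d + 1) → Fin d → ℤ
  affineIndependent : AffineIndependent ℝ (fun i => toReal (vertex i))

/-- The simplex as a subset of `ℝ^d`. -/
def LatticeSimplex.body {d : ℕ} (Δ : LatticeSimplex d) : Set (Fin d → ℝ) :=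
  convexHull ℝ (Set.range fun i => toReal (Δ.vertex i))

/-- The number `#(nP ∩ ℤ^d)` of lattice points in the `n`-th dilate of `P`. -/
def ehrhartCount {d : ℕ} (P : Set (Fin d → ℝ)) (n : ℕ) : ℕ :=
  Set.ncard {z : Fin d → ℤ | toReal z ∈ (n : ℝ) • P}

/-- `δ(P, t) = (1 - t)^(d+1) ∑_{n ≥ 0} #(nP ∩ ℤ^d) t^n` for a lattice polytope `P ⊂ ℝ^d` of
dimension `d`, as a formal power series (the term for `n = 0` is `1`, since `0 P = {0}`). -/
def deltaSeries {d : ℕ} (P : Set (Fin d → ℝ)) : PowerSeries ℤ :=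
  (1 - PowerSeries.X) ^ (d + 1) * PowerSeries.mk (fun n => (ehrhartCount P n : ℤ))

/-- The group of all `λ ∈ (ℝ/ℤ)^ι` such that `∑ i, λ_i (v_i, 1) ∈ ℤ^(d+1)`, that is, such that
`∑ i, λ_i (v_i, 1)` vanishes in `(ℝ/ℤ)^(d+1)`. -/
def associatedGroup {ι : Type*} [Fintype ι] {d : ℕ} (v : ι → Fin d → ℤ) :
    AddSubgroup (ι → UnitAddCircle) where
  carrier := {x | (∀ j, ∑ i, v i j • x i = 0) ∧ ∑ i, x i = 0}
  zero_mem' := by simp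
  add_mem' := by
    rintro a b ⟨ha, ha'⟩ ⟨hb, hb'⟩
    refine ⟨fun j => ?_, ?_⟩
    · simp [smul_add, Finset.sum_add_distrib, ha j, hb j]
    · simp [Finset.sum_add_distrib, ha', hb']
  neg_mem' := by
    rintro a ⟨ha, ha'⟩
    refine ⟨fun j => ?_, ?_⟩
    · simp [ha j]
    · simp [ha']

/-- `Q = f_U(P) + w` for a unimodular integer matrix `U` and an integer vector `w`, where
`f_U(x) = x U`. -/
def UnimodularlyEquivalent {d : ℕ} (P Q : Set (Fin d → ℝ)) : Prop :=
  ∃ (U : Matrix (Fin d) (Fin d) ℤ) (w : Fin d → ℤ), (U.det = 1 ∨ U.det = -1) ∧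
    Q = (fun x => Matrix.vecMul x (U.map (Int.cast : ℤ → ℝ)) + toReal w) '' P

/-- `Pyr(P) = conv(P × {0}, (0, …, 0, 1)) ⊂ ℝ^(d+1)`. -/
def pyramid {d : ℕ} (P : Set (Fin d → ℝ)) : Set (Fin (d + 1) → ℝ) :=
  convexHull ℝ
    (insert (Fin.snoc (α := fun _ => ℝ) (0 : Fin d → ℝ) 1)
      ((fun x : Fin d → ℝ => Fin.snoc (α := fun _ => ℝ) x 0) '' P))

/-- `P` is, up to unimodular equivalence, the lattice pyramid over a lattice simplex of one
dimension less. (An iterated pyramid over a simplex of still smaller dimension is of this form.) -/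
def IsLatticePyramid : (d : ℕ) → Set (Fin d → ℝ) → Prop
  | 0, _ => False
  | d + 1, P => ∃ Q : LatticeSimplex d, UnimodularlyEquivalent (pyramid Q.body) P

end GorensteinSimplex

end

/-! Define the height of an element of `Λ_Δ` as the sum of the representatives in `[0, 1)` of its
coordinates. A lattice point of the cone over `Δ` is, uniquely, such a vector of representatives
plus a nonnegative integral combination of the `(v_i, 1)`. So the `δ`-polynomial enumerates heights
(`deltaSeries_eq`), and the hypothesis says that they are the numbers `r (k + 1)`, `r < p ^ ℓ`, each
attained once.

Fractional parts are subadditive, hence so is the rank `r`. Let `x` have rank one and order `N`. As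
ranks are distinct, those in a coset of `⟨x⟩` are consecutive, so fractional parts add without carry
along the coset from its element of least rank. Therefore the nonzero coordinates of `x` equal `1 /
N`, and the least ranks of cosets are multiples of `N`. Multiplying the coordinates not vanishing at
`x` by `N` gives characters of the quotient by `⟨x⟩`; once their weights are divided by `N`, heights
are again equally spaced (`IsHeightRanking.quotient`). Weights are there to make this recursion
possible.

In a cyclic `p`-group a coordinate not vanishing at `x` is faithful, so it lies in the last block of
the quotient. A suitable lift of the generator takes the value `1 / p ^ n` there, and these
coordinates form a new last block; the weight which they remove from the old one produces the
differences of powers of `p` (`IsHeightRanking.exists_generator`). A coordinate in block zero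
vanishes on all of `Λ_Δ`, which makes `Δ` a lattice pyramid
(`isLatticePyramid_of_forall_apply_eq_zero`). -/

namespace GorensteinSimplex

/-! ### Fractional parts on the circle -/

/-- The representative in `[0, 1)` of a point of `ℝ/ℤ`. -/
noncomputable def frac (x : UnitAddCircle) : ℝ := (AddCircle.equivIco (1 : ℝ) 0 x : ℝ)

theorem frac_coe (r : ℝ) : frac (r : UnitAddCircle) = Int.fract r := by
  simp [frac, AddCircle.coe_equivIco_mk_apply]

theorem coe_frac (x : UnitAddCircle) : ((frac x : ℝ) : UnitAddCircle) = x :=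
  AddCircle.coe_equivIco

theorem frac_nonneg (x : UnitAddCircle) : 0 ≤ frac x := by
  rw [← coe_frac x, frac_coe]; exact Int.fract_nonneg _

theorem frac_lt_one (x : UnitAddCircle) : frac x < 1 := by
  rw [← coe_frac x, frac_coe]; exact Int.fract_lt_one _

theorem frac_zero : frac 0 = 0 := by
  have := frac_coe 0
  simpa using this

theorem frac_coe_of_mem {r : ℝ} (h0 : 0 ≤ r) (h1 : r < 1) : frac (r : UnitAddCircle) = r := by
  rw [frac_coe]; exact Int.fract_eq_self.2 ⟨h0, h1⟩

theorem frac_injective : Function.Injective frac := fun x y h => by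
  rw [← coe_frac x, ← coe_frac y, h]

theorem frac_add_le (x y : UnitAddCircle) : frac (x + y) ≤ frac x + frac y := by
  conv_lhs => rw [← coe_frac x, ← coe_frac y, ← AddCircle.coe_add, frac_coe]
  have := Int.fract_add_le (frac x) (frac y)
  rwa [← frac_coe, ← frac_coe, ← frac_coe, coe_frac, coe_frac, frac_coe] at this

theorem frac_nsmul_le (n : ℕ) (x : UnitAddCircle) : frac (n • x) ≤ n * frac x := by
  induction n with
  | zero => simp [frac_zero]
  | succ n ih =>
    rw [succ_nsmul]
    push_cast
    linarith [frac_add_le (n • x) x]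

theorem frac_nsmul_of_lt {n : ℕ} {x : UnitAddCircle} (h : n * frac x < 1) :
    frac (n • x) = n * frac x := by
  conv_lhs => rw [← coe_frac x, ← AddCircle.coe_nsmul, nsmul_eq_mul]
  exact frac_coe_of_mem (mul_nonneg n.cast_nonneg (frac_nonneg x)) h

theorem exists_int_of_nsmul_eq_zero {n : ℕ} {x : UnitAddCircle} (h : n • x = 0) :
    ∃ m : ℤ, n * frac x = m := by
  rw [← coe_frac x, ← AddCircle.coe_nsmul, AddCircle.coe_eq_zero_iff] at h
  obtain ⟨m, hm⟩ := h
  exact ⟨m, by simpa using hm.symm⟩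

/-! ### Height rankings and cosets of an element of rank one -/

/-- `rk` enumerates the values of the weighted height `g ↦ ∑ i, ω i * frac (χ i g)` on `G`: the
heights are the numbers `c * r` with `r < |G|`, each attained once. -/
structure IsHeightRanking {G ι : Type*} [AddCommGroup G] [Fintype ι]
    (χ : ι → G →+ UnitAddCircle) (ω : ι → ℝ) (c : ℝ) (rk : G → ℕ) : Prop where
  weight_pos : ∀ i, 0 < ω i
  pos : 0 < c
  height_eq : ∀ g, ∑ i, ω i * frac (χ i g) = c * rk g
  injective : Function.Injective rk
  lt_card : ∀ g, rk g < Nat.card G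

namespace IsHeightRanking

variable {G ι : Type*} [AddCommGroup G] [Fintype ι]
  {χ : ι → G →+ UnitAddCircle} {ω : ι → ℝ} {c : ℝ} {rk : G → ℕ}

theorem exists_eq (H : IsHeightRanking χ ω c rk) {r : ℕ} (hr : r < Nat.card G) :
    ∃ g, rk g = r := by
  have hb : Function.Bijective (fun g => (⟨rk g, H.lt_card g⟩ : Fin (Nat.card G))) := by
    rw [Nat.bijective_iff_injective_and_card]
    exact ⟨fun a b h => H.injective (by simpa using h), by simp⟩
  obtain ⟨g, hg⟩ := hb.2 ⟨r, hr⟩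
  exact ⟨g, by simpa using hg⟩

theorem rank_zero (H : IsHeightRanking χ ω c rk) : rk 0 = 0 := by
  have h := H.height_eq 0
  simp only [map_zero, frac_zero, mul_zero, Finset.sum_const_zero] at h
  have := H.pos.ne'
  simpa [this] using h.symm

theorem rank_add_le (H : IsHeightRanking χ ω c rk) (g g' : G) : rk (g + g') ≤ rk g + rk g' := by
  have h : c * (rk (g + g') : ℝ) ≤ c * ((rk g + rk g' : ℕ) : ℝ) := by
    push_cast
    rw [mul_add, ← H.height_eq, ← H.height_eq, ← H.height_eq, ← Finset.sum_add_distrib]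
    refine Finset.sum_le_sum fun i _ => ?_
    rw [← mul_add, map_add]
    exact mul_le_mul_of_nonneg_left (frac_add_le _ _) (H.weight_pos i).le
  exact_mod_cast le_of_mul_le_mul_left h H.pos

/-- Ranks grow by one at a time along a coset of an element of rank one. -/
theorem rank_add_nsmul (H : IsHeightRanking χ ω c rk) {x y : G} (hx : rk x = 1)
    (hy : ∀ j : ℕ, rk y ≤ rk (y + j • x)) (j : ℕ) (hj : j < addOrderOf x) :
    rk (y + j • x) = rk y + j := by
  induction j using Nat.strong_induction_on with
  | _ j ih =>
    rcases Nat.eq_zero_or_pos j with rfl | hpos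
    · simp
    have hle : rk (y + j • x) ≤ rk y + j := by
      have h1 := ih (j - 1) (by omega) (by omega)
      have h2 := H.rank_add_le (y + (j - 1) • x) x
      rw [add_assoc, ← succ_nsmul, Nat.sub_add_cancel hpos] at h2
      omega
    -- A smaller rank would already be taken by an earlier multiple of `x`, and multiples below the
    -- order of `x` are distinct.
    by_contra hne
    have hge := hy j
    have h1 := ih (rk (y + j • x) - rk y) (by omega) (by omega)
    rw [Nat.add_sub_cancel' hge] at h1
    have h2 := nsmul_injOn_Iio_addOrderOf (x := x) (Set.mem_Iio.2 (by omega)) (Set.mem_Iio.2 hj)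
      (add_left_cancel (H.injective h1))
    omega

/-- Subadditivity gives `≤` for each `i`. The weighted sums agree because the ranks do, and the
weights are positive, so every inequality is an equality. -/
theorem frac_add_nsmul (H : IsHeightRanking χ ω c rk) {x y : G} (hx : rk x = 1)
    (hy : ∀ j : ℕ, rk y ≤ rk (y + j • x)) (j : ℕ) (hj : j < addOrderOf x) (i : ι) :
    frac (χ i (y + j • x)) = frac (χ i y) + j * frac (χ i x) := by
  have hle : ∀ i ∈ Finset.univ, ω i * frac (χ i (y + j • x)) ≤
      ω i * (frac (χ i y) + j * frac (χ i x)) := fun i _ => by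
    refine mul_le_mul_of_nonneg_left ?_ (H.weight_pos i).le
    rw [map_add, map_nsmul]
    linarith [frac_add_le (χ i y) (j • χ i x), frac_nsmul_le j (χ i x)]
  have hsum : ∑ i, ω i * frac (χ i (y + j • x)) =
      ∑ i, ω i * (frac (χ i y) + j * frac (χ i x)) := by
    rw [H.height_eq, H.rank_add_nsmul hx hy j hj]
    simp_rw [mul_add, Finset.sum_add_distrib, mul_left_comm (ω _), ← Finset.mul_sum, H.height_eq,
      hx]
    push_cast
    ring
  exact mul_left_cancel₀ (H.weight_pos i).ne'
    ((Finset.sum_eq_sum_iff_of_le hle).1 hsum i (Finset.mem_univ i))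

variable [Finite G]

theorem one_lt_addOrderOf (H : IsHeightRanking χ ω c rk) {x : G} (hx : rk x = 1) :
    1 < addOrderOf x := by
  have h0 : addOrderOf x ≠ 1 := fun h => by
    rw [AddMonoid.addOrderOf_eq_one_iff] at h
    rw [h, H.rank_zero] at hx
    omega
  have := addOrderOf_pos x
  omega

/-- The value is `m / N` with `m > 0`. Additivity up to `(N - 1) • x` keeps `(N - 1) m / N` below
`1`, which excludes `m ≥ 2`. -/
theorem frac_of_rank_one (H : IsHeightRanking χ ω c rk) {x : G} (hx : rk x = 1) (i : ι)
    (hi : χ i x ≠ 0) : frac (χ i x) = 1 / addOrderOf x := by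
  set N := addOrderOf x with hN
  have h1 : 1 < N := H.one_lt_addOrderOf hx
  have h2 := H.frac_add_nsmul hx (y := 0) (by simp [H.rank_zero]) (N - 1) (by omega) i
  have h3 := frac_lt_one (χ i (0 + (N - 1) • x))
  rw [h2, map_zero, frac_zero, zero_add] at h3
  obtain ⟨m, hm⟩ := exists_int_of_nsmul_eq_zero (n := N) (x := χ i x)
    (by rw [← map_nsmul, addOrderOf_nsmul_eq_zero, map_zero])
  have hNr : (1 : ℝ) < N := by exact_mod_cast h1
  have hf : frac (χ i x) = m / N := by
    rw [eq_div_iff (by positivity), ← hm]; ring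
  have hpos : 0 < frac (χ i x) := by
    refine lt_of_le_of_ne (frac_nonneg _) fun h => hi ?_
    exact frac_injective (by rw [← h, frac_zero])
  have hm0 : 0 < m := by
    have : (0 : ℝ) < m := by rw [← hm]; positivity
    exact_mod_cast this
  rw [Nat.cast_sub h1.le, Nat.cast_one, hf] at h3
  have hm2 : m < 2 := by
    by_contra hcon
    have hm2 : (2 : ℝ) ≤ m := by exact_mod_cast not_lt.1 hcon
    have h4 : ((N : ℝ) - 1) * m < N := by
      rw [mul_div_assoc'] at h3
      rwa [div_lt_one (by positivity)] at h3
    have h5 : (2 : ℝ) ≤ N := by exact_mod_cast h1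
    nlinarith
  have : m = 1 := by omega
  rw [hf, this, Int.cast_one]

/-- Ensures that multiplying the coordinate by the order of `x` causes no carry at an element of
least rank in its coset. -/
theorem frac_lt_of_min (H : IsHeightRanking χ ω c rk) {x y : G} (hx : rk x = 1)
    (hy : ∀ j : ℕ, rk y ≤ rk (y + j • x)) (i : ι) (hi : χ i x ≠ 0) :
    addOrderOf x * frac (χ i y) < 1 := by
  have h1 := H.one_lt_addOrderOf hx
  have h2 := H.frac_add_nsmul hx hy (addOrderOf x - 1) (by omega) i
  have h3 := frac_lt_one (χ i (y + (addOrderOf x - 1) • x))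
  have hNr : (0 : ℝ) < addOrderOf x := by exact_mod_cast (by omega : 0 < addOrderOf x)
  rw [h2, H.frac_of_rank_one hx i hi, Nat.cast_sub h1.le, Nat.cast_one] at h3
  have h4 : frac (χ i y) < 1 / addOrderOf x := by
    have : ((addOrderOf x : ℝ) - 1) * (1 / addOrderOf x) = 1 - 1 / addOrderOf x := by
      field_simp
    linarith
  rw [lt_div_iff₀ hNr] at h4
  linarith

theorem exists_min (x g : G) (rk : G → ℕ) :
    ∃ y : G, (y : G ⧸ AddSubgroup.zmultiples x) = g ∧ ∀ j : ℕ, rk y ≤ rk (y + j • x) := by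
  obtain ⟨y, hy, hmin⟩ := Set.exists_min_image
    {y : G | (y : G ⧸ AddSubgroup.zmultiples x) = g} rk (Set.toFinite _) ⟨g, rfl⟩
  refine ⟨y, hy, fun j => hmin _ ?_⟩
  rw [Set.mem_ofPred_eq, ← (show (y : G ⧸ AddSubgroup.zmultiples x) = g from hy), eq_comm,
    QuotientAddGroup.eq]
  simp [AddSubgroup.nsmul_mem_zmultiples]

theorem exists_nsmul_of_eq {x y z : G}
    (h : (y : G ⧸ AddSubgroup.zmultiples x) = z) : ∃ j < addOrderOf x, z = y + j • x := by
  classical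
  rw [QuotientAddGroup.eq, mem_zmultiples_iff_mem_range_addOrderOf] at h
  obtain ⟨j, hj, h⟩ := Finset.mem_image.1 h
  refine ⟨j, Finset.mem_range.1 hj, ?_⟩
  rw [show j • x = -y + z from h]; abel

/-- Cosets occupy intervals of ranks of length `addOrderOf x`. The rank just below a minimum ends
the interval of another coset, so induction on the rank applies. -/
theorem dvd_rank_of_min (H : IsHeightRanking χ ω c rk) {x : G} (hx : rk x = 1) (y : G)
    (hy : ∀ j : ℕ, rk y ≤ rk (y + j • x)) : addOrderOf x ∣ rk y := by
  induction hv : rk y using Nat.strong_induction_on generalizing y with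
  | _ v ih =>
    rcases Nat.eq_zero_or_pos v with rfl | hpos
    · exact dvd_zero _
    obtain ⟨z, hz⟩ := H.exists_eq (r := v - 1) (by have := H.lt_card y; omega)
    obtain ⟨w, hw, hmin⟩ := exists_min x z rk
    obtain ⟨j, hj, rfl⟩ := exists_nsmul_of_eq hw
    have h1 := H.rank_add_nsmul hx hmin j hj
    have hd := ih (rk w) (by omega) w hmin rfl
    by_cases hjN : j + 1 < addOrderOf x
    · exfalso
      have h2 := H.rank_add_nsmul hx hmin (j + 1) hjN
      have h3 : w + (j + 1) • x = y := H.injective (by omega)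
      -- Completing the cycle from `y` leads back to `w`, whose rank is smaller.
      have h4 := hy (addOrderOf x - (j + 1))
      rw [← h3, add_assoc, ← add_nsmul, Nat.add_sub_cancel' hjN.le, addOrderOf_nsmul_eq_zero,
        add_zero] at h4
      omega
    · have : v = rk w + addOrderOf x := by omega
      rw [this]
      exact dvd_add hd dvd_rfl

end IsHeightRanking

/-! ### Passage to the quotient by an element of rank one -/

section Quotient

variable {G ι : Type*} [AddCommGroup G] (χ : ι → G →+ UnitAddCircle) (ω : ι → ℝ) (x : G)

open Classical in
/-- The characters induced on `G ⧸ ⟨x⟩`: those which do not vanish at `x` are multiplied by the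
order of `x`. -/
noncomputable def quotientChar (i : ι) : G ⧸ AddSubgroup.zmultiples x →+ UnitAddCircle :=
  QuotientAddGroup.lift _ (if χ i x = 0 then χ i else addOrderOf x • χ i) <| by
    rw [AddSubgroup.zmultiples_le]
    split_ifs with h
    · exact h
    · rw [AddMonoidHom.mem_ker, AddMonoidHom.nsmul_apply, ← map_nsmul, addOrderOf_nsmul_eq_zero,
        map_zero]

open Classical in
/-- The weights which go with `quotientChar`. -/
noncomputable def quotientWeight (i : ι) : ℝ := if χ i x = 0 then ω i else ω i / addOrderOf x

theorem quotientChar_of_eq {i : ι} (h : χ i x = 0) (g : G) : quotientChar χ x i g = χ i g := by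
  simp [quotientChar, h]

theorem quotientChar_of_ne {i : ι} (h : χ i x ≠ 0) (g : G) :
    quotientChar χ x i g = addOrderOf x • χ i g := by
  simp [quotientChar, h]

end Quotient

namespace IsHeightRanking

variable {G ι : Type*} [AddCommGroup G] [Finite G] [Fintype ι]
  {χ : ι → G →+ UnitAddCircle} {ω : ι → ℝ} {c : ℝ} {rk : G → ℕ}

/-- The height of a coset is that of its element of least rank: the factor `addOrderOf x` in a
character cancels the divisor in its weight. -/
theorem quotient (H : IsHeightRanking χ ω c rk) {x : G} (hx : rk x = 1) :
    ∃ rk', IsHeightRanking (quotientChar χ x) (quotientWeight χ ω x) (c * addOrderOf x) rk' := by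
  classical
  have hN : 0 < addOrderOf x := addOrderOf_pos x
  have hNr : (0 : ℝ) < addOrderOf x := by exact_mod_cast hN
  have hrep : ∀ q : G ⧸ AddSubgroup.zmultiples x, ∃ y : G,
      (y : G ⧸ AddSubgroup.zmultiples x) = q ∧ ∀ j : ℕ, rk y ≤ rk (y + j • x) := fun q => by
    induction q using QuotientAddGroup.induction_on with
    | H g => exact exists_min x g rk
  choose rep hq hmin using hrep
  choose rk' hrk' using fun q => H.dvd_rank_of_min hx (rep q) (hmin q)
  refine ⟨rk', ⟨fun i => ?_, mul_pos H.pos hNr, fun q => ?_, fun q q' h => ?_, fun q => ?_⟩⟩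
  · rw [quotientWeight]
    split_ifs
    · exact H.weight_pos i
    · exact div_pos (H.weight_pos i) hNr
  · have h1 := H.height_eq (rep q)
    rw [hrk' q] at h1
    push_cast at h1
    rw [mul_assoc, ← h1]
    refine Finset.sum_congr rfl fun i _ => ?_
    conv_lhs => rw [← hq q]
    by_cases h : χ i x = 0
    · rw [quotientChar_of_eq χ x h, quotientWeight, if_pos h]
    · rw [quotientChar_of_ne χ x h, quotientWeight, if_neg h,
        frac_nsmul_of_lt (H.frac_lt_of_min hx (hmin q) i h)]
      field_simp
  · rw [← hq q, ← hq q', H.injective (by rw [hrk' q, hrk' q', h] : rk (rep q) = rk (rep q'))]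
  · have h1 := H.lt_card (rep q)
    rw [AddSubgroup.card_eq_card_quotient_mul_card_addSubgroup (AddSubgroup.zmultiples x),
      Nat.card_zmultiples, hrk' q, mul_comm] at h1
    exact lt_of_mul_lt_mul_right h1 hN.le

/-- The height of `x` is `c`, and each `i` in its support contributes `ω i / addOrderOf x`. -/
theorem sum_weight_support [DecidableEq UnitAddCircle] (H : IsHeightRanking χ ω c rk) {x : G}
    (hx : rk x = 1) :
    ∑ i with χ i x ≠ 0, ω i = c * addOrderOf x := by
  have hNr : (0 : ℝ) < addOrderOf x := by exact_mod_cast addOrderOf_pos x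
  have h := H.height_eq x
  rw [hx, Nat.cast_one, mul_one] at h
  rw [← h, Finset.sum_mul, Finset.sum_filter]
  refine Finset.sum_congr rfl fun i _ => ?_
  split_ifs with hi
  · rw [H.frac_of_rank_one hx i hi]
    field_simp
  · rw [not_not.1 hi, frac_zero]; ring

end IsHeightRanking

/-! ### Classification for cyclic `p`-groups -/

/-- A homomorphism from a cyclic `p`-group which is faithful on a nontrivial cyclic subgroup is
faithful. -/
theorem addOrderOf_map_generator {G A : Type*} [AddCommGroup G] [Finite G] [AddCommGroup A]
    {p n : ℕ} (hp : p.Prime) (hcard : Nat.card G = p ^ n) {γ : G}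
    (hγ : ∀ y, y ∈ AddSubgroup.zmultiples γ) (f : G →+ A) {x : G} (hx : x ≠ 0)
    (hfx : addOrderOf (f x) = addOrderOf x) : addOrderOf (f γ) = p ^ n := by
  have hoγ : addOrderOf γ = p ^ n := by rw [addOrderOf_eq_card_of_forall_mem_zmultiples hγ, hcard]
  obtain ⟨m, hm, hmo⟩ := (Nat.dvd_prime_pow hp).1 (hoγ ▸ addOrderOf_map_dvd f γ)
  obtain ⟨r, hr, hro⟩ := (Nat.dvd_prime_pow hp).1 (hcard ▸ addOrderOf_dvd_natCard x)
  have hr0 : r ≠ 0 := by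
    rintro rfl
    rw [pow_zero, AddMonoid.addOrderOf_eq_one_iff] at hro
    exact hx hro
  rcases hm.eq_or_lt with rfl | hlt
  · exact hmo
  exfalso
  -- If `f γ` had smaller order, `p ^ (n - 1)` would kill it. As `x` is a multiple of `p ^ (n - r) •
  -- γ`, already `p ^ (r - 1)` would kill `f x`.
  have hfγ : p ^ (n - 1) • f γ = 0 := by
    rw [← addOrderOf_dvd_iff_nsmul_eq_zero, hmo]
    exact pow_dvd_pow p (by omega)
  obtain ⟨j, rfl⟩ := AddSubgroup.mem_zmultiples_iff.1 (hγ x)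
  have h1 : (p ^ r : ℕ) • j • γ = 0 := by rw [← hro]; exact addOrderOf_nsmul_eq_zero _
  rw [← natCast_zsmul, ← mul_zsmul, ← addOrderOf_dvd_iff_zsmul_eq_zero, hoγ] at h1
  have h2 : ((p : ℤ) ^ (n - r)) ∣ j := by
    have hp0 : ((p : ℤ) ^ r) ≠ 0 := pow_ne_zero _ (by exact_mod_cast hp.ne_zero)
    refine (mul_dvd_mul_iff_left hp0).1 ?_
    rw [← pow_add, Nat.add_sub_cancel' hr]
    exact_mod_cast h1
  obtain ⟨j', rfl⟩ := h2
  have h3 : (p ^ (r - 1)) • f (((p : ℤ) ^ (n - r) * j') • γ) = 0 := by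
    rw [map_zsmul, ← natCast_zsmul, ← mul_zsmul]
    have : ((p ^ (r - 1) : ℕ) : ℤ) * ((p : ℤ) ^ (n - r) * j') = j' * ((p ^ (n - 1) : ℕ) : ℤ) := by
      push_cast
      rw [← mul_assoc, ← pow_add, mul_comm, show r - 1 + (n - r) = n - 1 by omega]
    rw [this, mul_zsmul, natCast_zsmul, hfγ, zsmul_zero]
  have h4 := addOrderOf_dvd_of_nsmul_eq_zero h3
  rw [hfx, hro] at h4
  have := (Nat.pow_dvd_pow_iff_le_right hp.one_lt).1 h4
  omega

end GorensteinSimplex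

namespace GorensteinSimplex

theorem coe_one_div_pow {p : ℕ} (hp : p.Prime) (m : ℕ) :
    addOrderOf (((1 : ℝ) / (p : ℝ) ^ m : ℝ) : UnitAddCircle) = p ^ m := by
  have h := AddCircle.addOrderOf_period_div (p := (1 : ℝ)) (n := p ^ m) (pow_pos hp.pos m)
  rwa [Nat.cast_pow] at h

/-- Classification of the height rankings of cyclic `p`-groups. -/
theorem IsHeightRanking.exists_generator {p : ℕ} (hp : p.Prime) {ι : Type*} [Fintype ι] (n : ℕ) :
    ∀ {G : Type*} [AddCommGroup G] [Finite G] [IsAddCyclic G] {χ : ι → G →+ UnitAddCircle}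
      {ω : ι → ℝ} {c : ℝ} {rk : G → ℕ}, Nat.card G = p ^ n → IsHeightRanking χ ω c rk →
    ∃ (t : ℕ) (e : ℕ → ℕ) (idx : ι → ℕ) (g : G), e 0 = 0 ∧ StrictMonoOn e (Set.Iic t) ∧ e t = n ∧
      (∀ i, idx i ≤ t) ∧ (∀ y, y ∈ AddSubgroup.zmultiples g) ∧
      (∀ i, χ i g = (((1 : ℝ) / (p : ℝ) ^ e (idx i) : ℝ) : UnitAddCircle)) ∧
      (∀ j, 1 ≤ j → j < t → ∑ i with idx i = j, ω i =
        c * ((p : ℝ) ^ (n - e (j - 1)) - (p : ℝ) ^ (n - e (j + 1)))) ∧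
      (1 ≤ t → ∑ i with idx i = t, ω i = c * (p : ℝ) ^ (n - e (t - 1))) := by
  classical
  induction n using Nat.strong_induction_on with
  | _ n ih =>
  intro G _ _ _ χ ω c rk hcard H
  rcases Nat.eq_zero_or_pos n with rfl | hn
  · have hs : Subsingleton G := (Nat.card_eq_one_iff_unique.1 (by simpa using hcard)).1
    refine ⟨0, fun _ => 0, fun _ => 0, 0, rfl, ?_, rfl, fun _ => le_rfl, fun y => ?_, fun i => ?_,
      fun j hj hj' => by omega, fun h => by omega⟩
    · intro a ha b hb hab
      simp only [Set.mem_Iic] at ha hb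
      omega
    · rw [Subsingleton.elim y 0]; exact zero_mem _
    · simp [AddCircle.coe_period]
  have hp1 : (1 : ℝ) < p := by exact_mod_cast hp.one_lt
  have hp0 : (0 : ℝ) < p := by linarith
  obtain ⟨x, hx⟩ := H.exists_eq (r := 1) (by rw [hcard]; exact Nat.one_lt_pow hn.ne' hp.one_lt)
  have hx1 := H.one_lt_addOrderOf hx
  have hx0 : x ≠ 0 := by rintro rfl; simp at hx1
  obtain ⟨r, hrn, hr⟩ := (Nat.dvd_prime_pow hp).1 (hcard ▸ addOrderOf_dvd_natCard x)
  have hr0 : 0 < r := by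
    rcases Nat.eq_zero_or_pos r with rfl | h
    · rw [hr] at hx1; simp at hx1
    · exact h
  have hcard' : Nat.card (G ⧸ AddSubgroup.zmultiples x) = p ^ (n - r) := by
    have h := AddSubgroup.card_eq_card_quotient_mul_card_addSubgroup (AddSubgroup.zmultiples x)
    rw [Nat.card_zmultiples, hcard, hr] at h
    refine Nat.eq_of_mul_eq_mul_right (pow_pos hp.pos r) ?_
    rw [← h, ← pow_add, Nat.sub_add_cancel hrn]
  obtain ⟨rk', H'⟩ := H.quotient hx
  have : IsAddCyclic (G ⧸ AddSubgroup.zmultiples x) :=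
    isAddCyclic_of_surjective (QuotientAddGroup.mk' (AddSubgroup.zmultiples x))
      (QuotientAddGroup.mk'_surjective _)
  obtain ⟨t, e, idx, q, he0, hmono, het, hidx, hgen, hχ, hsum, hsumt⟩ :=
    ih (n - r) (by omega) hcard' H'
  obtain ⟨γ, hγ⟩ := IsAddCyclic.exists_generator (α := G)
  -- the characters which do not vanish at `x` are faithful
  have horder : ∀ i, χ i x ≠ 0 → addOrderOf (χ i γ) = p ^ n := fun i hi => by
    refine addOrderOf_map_generator hp hcard hγ (χ i) hx0 ?_
    have h := H.frac_of_rank_one hx i hi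
    rw [← coe_frac (χ i x), h]
    exact AddCircle.addOrderOf_period_div (p := (1 : ℝ)) (by omega)
  have hidxA : ∀ i, χ i x ≠ 0 → idx i = t := fun i hi => by
    refine hmono.injOn (Set.mem_Iic.2 (hidx i)) (Set.mem_Iic.2 le_rfl) ?_
    rw [het]
    -- The value at the generator `q` bounds the order of all values by `p ^ e (idx i)`, while
    -- faithfulness gives a value of order `p ^ (n - r)`.
    have h1 : ∀ z, p ^ e (idx i) • quotientChar χ x i z = 0 := fun z => by
      obtain ⟨m, rfl⟩ := AddSubgroup.mem_zmultiples_iff.1 (hgen z)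
      rw [map_zsmul, smul_comm, hχ i]
      have := addOrderOf_nsmul_eq_zero (((1 : ℝ) / (p : ℝ) ^ e (idx i) : ℝ) : UnitAddCircle)
      rw [coe_one_div_pow hp] at this
      rw [this, smul_zero]
    have h2 := h1 (γ : G ⧸ AddSubgroup.zmultiples x)
    rw [quotientChar_of_ne χ x hi, hr, ← mul_nsmul', ← addOrderOf_dvd_iff_nsmul_eq_zero,
      horder i hi, ← pow_add] at h2
    have h3 := (Nat.pow_dvd_pow_iff_le_right hp.one_lt).1 h2
    have h4 := hmono.monotoneOn (Set.mem_Iic.2 (hidx i)) (Set.mem_Iic.2 le_rfl) (hidx i)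
    omega
  have hlift : ∃ g : G, (g : G ⧸ AddSubgroup.zmultiples x) = q ∧
      ∀ i, χ i x ≠ 0 → χ i g = (((1 : ℝ) / (p : ℝ) ^ n : ℝ) : UnitAddCircle) := by
    -- For `n = r` the quotient is trivial and the least-rank lift would be `0`, so `x` itself
    -- serves as the generator. Otherwise `1 / p ^ (n - r) < 1`, and the absence of carries permits
    -- division by `p ^ r`.
    by_cases hnr : n = r
    · subst hnr
      have : Subsingleton (G ⧸ AddSubgroup.zmultiples x) :=
        (Nat.card_eq_one_iff_unique.1 (by simpa using hcard')).1
      refine ⟨x, Subsingleton.elim _ _, fun i hi => ?_⟩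
      rw [← coe_frac (χ i x), H.frac_of_rank_one hx i hi, hr, Nat.cast_pow]
    · obtain ⟨g₀, rfl⟩ := QuotientAddGroup.mk_surjective q
      obtain ⟨g, hg, hmin⟩ := IsHeightRanking.exists_min x g₀ rk
      refine ⟨g, hg, fun i hi => ?_⟩
      have h1 := hχ i
      rw [← hg, hidxA i hi, het, quotientChar_of_ne χ x hi] at h1
      have h2 := frac_nsmul_of_lt (H.frac_lt_of_min hx hmin i hi)
      have hlt : (1 : ℝ) / (p : ℝ) ^ (n - r) < 1 := by
        rw [div_lt_one (by positivity)]
        exact one_lt_pow₀ hp1 (by omega)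
      rw [h1, frac_coe_of_mem (by positivity) hlt, hr] at h2
      rw [← coe_frac (χ i g)]
      congr 1
      rw [Nat.cast_pow] at h2
      rw [eq_div_iff (by positivity), ← Nat.sub_add_cancel hrn, pow_add, mul_left_comm,
        mul_comm (frac _), ← h2]
      field_simp
  obtain ⟨g, hgq, hgA⟩ := hlift
  have hsupp := H.sum_weight_support hx
  have hne : ∃ i, χ i x ≠ 0 := by
    by_contra hcon
    push Not at hcon
    rw [Finset.sum_eq_zero (fun i hi => absurd (hcon i) (Finset.mem_filter.1 hi).2)] at hsupp
    have : 0 < c * addOrderOf x := mul_pos H.pos (by exact_mod_cast (by omega))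
    linarith
  have hggen : ∀ y, y ∈ AddSubgroup.zmultiples g := by
    obtain ⟨i, hi⟩ := hne
    have h1 : addOrderOf g = Nat.card G := by
      refine Nat.dvd_antisymm (addOrderOf_dvd_natCard g) ?_
      have := addOrderOf_map_dvd (χ i) g
      rwa [hgA i hi, coe_one_div_pow hp, ← hcard] at this
    have h2 : AddSubgroup.zmultiples g = ⊤ := by
      apply AddSubgroup.eq_top_of_card_eq
      rw [Nat.card_zmultiples, h1]
    intro y
    rw [h2]
    exact AddSubgroup.mem_top y
  -- The support of `x` becomes block `t + 1`, with exponent `n`; all other indices keep their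
  -- block.
  refine ⟨t + 1, fun j => if j ≤ t then e j else n,
    fun i => if χ i x = 0 then idx i else t + 1, g, by simp [he0], ?_, by simp, ?_, hggen, ?_, ?_,
    ?_⟩
  · intro a ha b hb hab
    simp only [Set.mem_Iic] at ha hb
    have hat : a ≤ t := by omega
    simp only [hat, if_true]
    split_ifs with hbt
    · exact hmono (Set.mem_Iic.2 hat) (Set.mem_Iic.2 hbt) hab
    · have := hmono.monotoneOn (Set.mem_Iic.2 hat) (Set.mem_Iic.2 le_rfl) hat
      omega
  · intro i
    have := hidx i
    dsimp only
    split_ifs <;> omega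
  · intro i
    dsimp only
    by_cases hi : χ i x = 0
    · rw [if_pos hi, if_pos (hidx i), ← hχ i, ← hgq, quotientChar_of_eq χ x hi]
    · rw [if_neg hi, if_neg (by omega), hgA i hi]
  · intro j hj hjt
    have hpw : ∀ k, k ≤ t → e k ≤ n - r := fun k hk => het ▸
      hmono.monotoneOn (Set.mem_Iic.2 hk) (Set.mem_Iic.2 le_rfl) hk
    have hsplit : ∀ k, k ≤ t → (p : ℝ) ^ r * (p : ℝ) ^ (n - r - e k) = (p : ℝ) ^ (n - e k) :=
      fun k hk => by
        have := hpw k hk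
        rw [← pow_add]; congr 1; omega
    -- the new block `j` consists of the old one without the characters not vanishing at `x`
    have hold : ∑ i with idx i = j, quotientWeight χ ω x i =
        (∑ i with (if χ i x = 0 then idx i else t + 1) = j, ω i) +
          if j = t then c else 0 := by
      have h1 : (if j = t then c else 0) =
          ∑ i with idx i = j, if χ i x = 0 then 0 else ω i / addOrderOf x := by
        have hNr : (addOrderOf x : ℝ) ≠ 0 := by exact_mod_cast (by omega)
        split_ifs with hjt'
        · rw [← mul_div_cancel_right₀ c hNr, ← hsupp, Finset.sum_div, Finset.sum_filter,
            Finset.sum_filter]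
          refine Finset.sum_congr rfl fun i _ => ?_
          by_cases hi : χ i x = 0
          · simp [hi]
          · simp [hi, hidxA i hi, hjt']
        · refine (Finset.sum_eq_zero fun i hi => ?_).symm
          rw [Finset.mem_filter] at hi
          rw [if_pos]
          by_contra hcon
          exact hjt' (hi.2.symm.trans (hidxA i hcon))
      rw [h1, Finset.sum_filter, Finset.sum_filter, Finset.sum_filter, ← Finset.sum_add_distrib]
      refine Finset.sum_congr rfl fun i _ => ?_
      by_cases hi : χ i x = 0
      · simp [hi, quotientWeight]
      · have : t + 1 ≠ j := by omega
        simp [hi, quotientWeight, this]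
    have hrN : (addOrderOf x : ℝ) = (p : ℝ) ^ r := by rw [hr, Nat.cast_pow]
    dsimp only
    rw [if_pos (by omega : j - 1 ≤ t)]
    rcases (by omega : j < t ∨ j = t) with hlt | rfl
    · rw [hsum j hj hlt, if_neg hlt.ne, add_zero, hrN] at hold
      rw [← hold, if_pos (by omega : j + 1 ≤ t), ← hsplit _ (by omega : j - 1 ≤ t),
        ← hsplit _ (by omega : j + 1 ≤ t)]
      ring
    -- The weight `c` lost by the old last block is the term `c * p ^ (n - n)` of the formula.
    · rw [hsumt hj, if_pos rfl, hrN] at hold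
      rw [eq_sub_of_add_eq hold.symm, if_neg (by omega), ← hsplit _ (by omega : j - 1 ≤ j)]
      simp
      ring
  · intro _
    have hrN : (addOrderOf x : ℝ) = (p : ℝ) ^ r := by rw [hr, Nat.cast_pow]
    simp only [Nat.add_sub_cancel, le_refl, if_true, het, Nat.sub_sub_self hrn]
    rw [← hrN, ← hsupp]
    congr 1
    ext i
    simp only [Finset.mem_filter, Finset.mem_univ, true_and]
    have := hidx i
    by_cases hi : χ i x = 0
    · simp only [hi, if_true, ne_eq, not_true, iff_false]; omega
    · simp [hi]

end GorensteinSimplex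

/-! ### Barycentric coordinates and the associated group -/

namespace GorensteinSimplex

theorem coe_sum {ι : Type*} (s : Finset ι) (f : ι → ℝ) :
    ((∑ i ∈ s, f i : ℝ) : UnitAddCircle) = ∑ i ∈ s, (f i : UnitAddCircle) :=
  map_sum (QuotientAddGroup.mk' (AddSubgroup.zmultiples (1 : ℝ))) f s

theorem coe_eq_zero_iff_exists_int (r : ℝ) : (r : UnitAddCircle) = 0 ↔ ∃ m : ℤ, r = m := by
  rw [AddCircle.coe_eq_zero_iff]
  simp [eq_comm]

theorem coe_mem_associatedGroup_iff {ι : Type*} [Fintype ι] {d : ℕ} (v : ι → Fin d → ℤ)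
    (c : ι → ℝ) : (fun i => (c i : UnitAddCircle)) ∈ associatedGroup v ↔
      (∃ z : Fin d → ℤ, ∑ i, c i • toReal (v i) = toReal z) ∧ ∃ m : ℤ, ∑ i, c i = m := by
  have h : (fun i => (c i : UnitAddCircle)) ∈ associatedGroup v ↔
      (∀ j, ((∑ i, c i * v i j : ℝ) : UnitAddCircle) = 0) ∧
        ((∑ i, c i : ℝ) : UnitAddCircle) = 0 := by
    simp only [coe_sum]
    refine and_congr (forall_congr' fun j => ?_) Iff.rfl
    refine Eq.congr_left (Finset.sum_congr rfl fun i _ => ?_)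
    rw [← AddCircle.coe_zsmul, zsmul_eq_mul, mul_comm]
  rw [h, coe_eq_zero_iff_exists_int]
  refine and_congr_left fun _ => ?_
  simp only [coe_eq_zero_iff_exists_int]
  constructor
  · intro h
    choose z hz using h
    exact ⟨z, funext fun j => by simpa [toReal] using hz j⟩
  · rintro ⟨z, hz⟩ j
    exact ⟨z j, by simpa [toReal] using congr_fun hz j⟩

namespace LatticeSimplex

variable {d : ℕ} (Δ : LatticeSimplex d)

/-- The vertices of a lattice simplex, as an affine basis of the ambient space. -/
noncomputable def affineBasis : AffineBasis (Fin (d + 1)) ℝ (Fin d → ℝ) where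
  toFun i := toReal (Δ.vertex i)
  ind' := Δ.affineIndependent
  tot' := by
    rw [Δ.affineIndependent.affineSpan_eq_top_iff_card_eq_finrank_add_one]
    simp

theorem affineBasis_apply (i : Fin (d + 1)) : Δ.affineBasis i = toReal (Δ.vertex i) := rfl

theorem sum_coord_smul (x : Fin d → ℝ) :
    ∑ i, Δ.affineBasis.coord i x • toReal (Δ.vertex i) = x :=
  Δ.affineBasis.linear_combination_coord_eq_self x

theorem coord_linear_eq (i : Fin (d + 1)) (x : Fin d → ℝ) :
    (Δ.affineBasis.coord i).linear x = Δ.affineBasis.coord i x - Δ.affineBasis.coord i 0 := by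
  have := (Δ.affineBasis.coord i).linearMap_vsub x 0
  simpa using this

/-- Barycentric coordinates of lattice vectors represent elements of the associated group. -/
theorem coord_linear_mem (z : Fin d → ℤ) :
    (fun i => (((Δ.affineBasis.coord i).linear (toReal z) : ℝ) : UnitAddCircle)) ∈
      associatedGroup Δ.vertex := by
  rw [coe_mem_associatedGroup_iff]
  simp only [coord_linear_eq]
  refine ⟨⟨z, ?_⟩, 0, ?_⟩
  · simp only [sub_smul, Finset.sum_sub_distrib, sum_coord_smul, sub_zero]
  · simp [Finset.sum_sub_distrib]

end LatticeSimplex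

/-! ### Unimodular maps and lattice pyramids -/

theorem toReal_vecMul_add {m n : ℕ} (U : Matrix (Fin m) (Fin n) ℤ) (w : Fin n → ℤ)
    (y : Fin m → ℤ) : Matrix.vecMul (toReal y) (U.map (Int.cast : ℤ → ℝ)) + toReal w =
      toReal (Matrix.vecMul y U + w) := by
  ext j
  simp [toReal, Matrix.vecMul, dotProduct]

theorem toReal_snoc {d : ℕ} (y : Fin d → ℤ) (a : ℤ) :
    toReal (Fin.snoc (α := fun _ => ℤ) y a) = Fin.snoc (α := fun _ => ℝ) (toReal y) (a : ℝ) := by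
  ext j
  induction j using Fin.lastCases <;> simp [toReal]

theorem vecMul_snoc {d n : ℕ} (a : Fin d → ℤ) (α : ℤ) (b : Fin d → Fin n → ℤ) (u : Fin n → ℤ) :
    Matrix.vecMul (Fin.snoc (α := fun _ => ℤ) a α)
      (Matrix.of (Fin.snoc (α := fun _ => Fin n → ℤ) b u)) = ∑ i, a i • b i + α • u := by
  ext j
  simp [Matrix.vecMul, dotProduct, Fin.sum_univ_castSucc]

/-- A functional on a lattice taking the value `1` at `u` extends `u` to a lattice basis of which
the other members lie in the kernel. -/
theorem exists_unimodular {d : ℕ} (φ : (Fin (d + 1) → ℤ) →ₗ[ℤ] ℤ) (u : Fin (d + 1) → ℤ)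
    (hu : φ u = 1) : ∃ U : Matrix (Fin (d + 1)) (Fin (d + 1)) ℤ, (U.det = 1 ∨ U.det = -1) ∧
      Matrix.vecMul (Fin.snoc (α := fun _ => ℤ) 0 1) U = u ∧
      ∀ z, ∃ a : Fin d → ℤ, Matrix.vecMul (Fin.snoc (α := fun _ => ℤ) a (φ z)) U = z := by
  have hsurj : Function.Surjective φ := fun m => ⟨m • u, by rw [map_smul, hu, smul_eq_mul, mul_one]⟩
  have hrank : Module.finrank ℤ (LinearMap.ker φ) = d := by
    have h := Submodule.finrank_quotient_add_finrank (LinearMap.ker φ)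
    rw [(φ.quotKerEquivOfSurjective hsurj).finrank_eq, Module.finrank_self,
      Module.finrank_fin_fun] at h
    omega
  let b : Module.Basis (Fin d) ℤ (LinearMap.ker φ) := Module.finBasisOfFinrankEq ℤ _ hrank
  let U : Matrix (Fin (d + 1)) (Fin (d + 1)) ℤ :=
    Matrix.of (Fin.snoc (α := fun _ => Fin (d + 1) → ℤ) (fun i => (b i : Fin (d + 1) → ℤ)) u)
  have hU : ∀ z, ∃ a : Fin d → ℤ, Matrix.vecMul (Fin.snoc (α := fun _ => ℤ) a (φ z)) U = z :=
    fun z => by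
    have hz : z - φ z • u ∈ LinearMap.ker φ := by
      rw [LinearMap.mem_ker, map_sub, map_smul, hu, smul_eq_mul, mul_one, sub_self]
    refine ⟨b.repr ⟨z - φ z • u, hz⟩, ?_⟩
    rw [vecMul_snoc]
    have h := congr_arg Subtype.val (b.sum_repr ⟨z - φ z • u, hz⟩)
    simp only [Submodule.coe_sum, Submodule.coe_smul] at h
    rw [h, sub_add_cancel]
  refine ⟨U, ?_, ?_, hU⟩
  · choose a ha using hU
    -- The rows of `V` are the coordinates of the standard basis vectors, so `V` is an integral
    -- inverse of `U`.
    let V : Matrix (Fin (d + 1)) (Fin (d + 1)) ℤ :=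
      Matrix.of fun j => Fin.snoc (α := fun _ => ℤ) (a (Pi.single j 1)) (φ (Pi.single j 1))
    have hVU : V * U = 1 := by
      ext j k
      rw [Matrix.mul_apply_eq_vecMul]
      rw [show V j = Fin.snoc (α := fun _ => ℤ) (a (Pi.single j 1)) (φ (Pi.single j 1)) from rfl,
        ha, Matrix.one_apply, Pi.single_apply]
      simp [eq_comm]
    have hdet := congr_arg Matrix.det hVU
    rw [Matrix.det_mul, Matrix.det_one] at hdet
    exact Int.isUnit_iff.1 (IsUnit.of_mul_eq_one_right _ hdet)
  · rw [vecMul_snoc]; simp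

theorem pyramid_convexHull_range {d n : ℕ} (q : Fin n → Fin d → ℝ) :
    pyramid (convexHull ℝ (Set.range q)) = convexHull ℝ
      (insert (Fin.snoc (α := fun _ => ℝ) (0 : Fin d → ℝ) 1)
        (Set.range fun i => Fin.snoc (α := fun _ => ℝ) (q i) 0)) := by
  let L : (Fin d → ℝ) →ₗ[ℝ] (Fin (d + 1) → ℝ) :=
    { toFun := fun x => Fin.snoc (α := fun _ => ℝ) x 0
      map_add' := fun x y => by ext j; induction j using Fin.lastCases <;> simp
      map_smul' := fun r x => by ext j; induction j using Fin.lastCases <;> simp }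
  have h := L.image_convexHull (Set.range q)
  rw [← Set.range_comp] at h
  rw [pyramid, Set.insert_eq, show (fun x : Fin d → ℝ => Fin.snoc (α := fun _ => ℝ) x 0) = ⇑L
    from rfl, h, convexHull_convexHull_union_right]
  rfl

/-- A simplex whose associated group has a vanishing coordinate is a lattice pyramid. -/
theorem isLatticePyramid_of_forall_apply_eq_zero {d : ℕ} (Δ : LatticeSimplex (d + 1))
    (i₀ : Fin (d + 2)) (h : ∀ x ∈ associatedGroup Δ.vertex, x i₀ = 0) :
    IsLatticePyramid (d + 1) Δ.body := by
  let w := Δ.vertex (i₀.succAbove 0)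
  -- The linear part of the barycentric coordinate at `i₀` is integral on the lattice. It gives the
  -- functional `φ`, the lattice height of the apex over the opposite facet being `1`.
  have hint : ∀ z : Fin (d + 1) → ℤ, ∃ m : ℤ,
      (Δ.affineBasis.coord i₀).linear (toReal z) = m := fun z =>
    (coe_eq_zero_iff_exists_int _).1 (h _ (Δ.coord_linear_mem z))
  choose f hf using hint
  let φ : (Fin (d + 1) → ℤ) →ₗ[ℤ] ℤ := AddMonoidHom.toIntLinearMap <|
    AddMonoidHom.mk' f fun a b => by
      have h1 : toReal (a + b) = toReal a + toReal b := by ext j; simp [toReal]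
      have h2 := hf (a + b)
      rw [h1, map_add, hf, hf] at h2
      exact_mod_cast h2.symm
  have hφ : ∀ i, (φ (Δ.vertex i - w) : ℝ) = if i₀ = i then 1 else 0 := fun i => by
    have h1 : toReal (Δ.vertex i - w) = toReal (Δ.vertex i) - toReal w := by
      ext j; simp [toReal]
    have h2 : ((φ (Δ.vertex i - w) : ℤ) : ℝ) = _ := (hf (Δ.vertex i - w)).symm
    rw [h2, h1, map_sub, Δ.coord_linear_eq, Δ.coord_linear_eq, sub_sub_sub_cancel_right,
      ← Δ.affineBasis_apply, ← Δ.affineBasis_apply, AffineBasis.coord_apply,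
      AffineBasis.coord_apply, if_neg (Fin.ne_succAbove i₀ 0), sub_zero]
  obtain ⟨U, hdet, hapex, hU⟩ := exists_unimodular φ (Δ.vertex i₀ - w)
    (by have := hφ i₀; rw [if_pos rfl] at this; exact_mod_cast this)
  have hbase : ∀ i, ∃ a : Fin d → ℤ, Matrix.vecMul (Fin.snoc (α := fun _ => ℤ) a 0) U + w =
      Δ.vertex (i₀.succAbove i) := fun i => by
    obtain ⟨a, ha⟩ := hU (Δ.vertex (i₀.succAbove i) - w)
    have h0 : φ (Δ.vertex (i₀.succAbove i) - w) = 0 := by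
      have := hφ (i₀.succAbove i)
      rw [if_neg (Fin.ne_succAbove i₀ i)] at this
      exact_mod_cast this
    rw [h0] at ha
    exact ⟨a, by rw [ha, sub_add_cancel]⟩
  choose q hq using hbase
  let F : (Fin (d + 1) → ℝ) →ᵃ[ℝ] (Fin (d + 1) → ℝ) :=
    (Matrix.vecMulLinear (U.map (Int.cast : ℤ → ℝ))).toAffineMap +
      AffineMap.const ℝ _ (toReal w)
  have hF : ∀ x, F x = Matrix.vecMul x (U.map (Int.cast : ℤ → ℝ)) + toReal w := fun x => by
    simp [F]
  have hFapex : F (Fin.snoc (α := fun _ => ℝ) (0 : Fin d → ℝ) 1) = toReal (Δ.vertex i₀) := by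
    have h1 := toReal_snoc (0 : Fin d → ℤ) 1
    have h2 : toReal (0 : Fin d → ℤ) = 0 := by ext j; simp [toReal]
    rw [h2, Int.cast_one] at h1
    rw [← h1, hF, toReal_vecMul_add, hapex, sub_add_cancel]
  have hFbase : ∀ i, F (Fin.snoc (α := fun _ => ℝ) (toReal (q i)) 0) =
      toReal (Δ.vertex (i₀.succAbove i)) := fun i => by
    have h1 := toReal_snoc (q i) 0
    rw [Int.cast_zero] at h1
    rw [← h1, hF, toReal_vecMul_add, hq]
  let S : (Fin d → ℝ) →ᵃ[ℝ] (Fin (d + 1) → ℝ) := LinearMap.toAffineMap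
    { toFun := fun x => Fin.snoc (α := fun _ => ℝ) x 0
      map_add' := fun x y => by ext j; induction j using Fin.lastCases <;> simp
      map_smul' := fun r x => by ext j; induction j using Fin.lastCases <;> simp }
  have hind : AffineIndependent ℝ fun i => toReal (q i) := by
    refine AffineIndependent.of_comp (F.comp S) ?_
    have h1 := Δ.affineIndependent.comp_embedding i₀.succAboveEmb
    convert h1 using 1
    funext i
    exact hFbase i
  refine ⟨⟨q, hind⟩, U, w, hdet, ?_⟩
  have hfun : (fun x => Matrix.vecMul x (U.map (Int.cast : ℤ → ℝ)) + toReal w) = ⇑F :=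
    funext fun x => (hF x).symm
  rw [hfun, LatticeSimplex.body, LatticeSimplex.body, pyramid_convexHull_range,
    AffineMap.image_convexHull, Set.image_insert_eq, hFapex, ← Set.range_comp]
  congr 1
  have hcomp : (⇑F ∘ fun i => Fin.snoc (α := fun _ => ℝ) (toReal (q i)) 0) =
      fun i => toReal (Δ.vertex (i₀.succAbove i)) := funext hFbase
  rw [hcomp]
  ext y
  simp only [Set.mem_range, Set.mem_insert_iff]
  constructor
  · rintro ⟨i, rfl⟩
    rcases Fin.eq_self_or_eq_succAbove i₀ i with rfl | ⟨j, rfl⟩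
    · exact Or.inl rfl
    · exact Or.inr ⟨j, rfl⟩
  · rintro (rfl | ⟨j, rfl⟩)
    · exact ⟨i₀, rfl⟩
    · exact ⟨_, rfl⟩

end GorensteinSimplex

/-! ### Lattice points of dilates and the `δ`-polynomial -/

open scoped Pointwise

namespace GorensteinSimplex

namespace LatticeSimplex

variable {d : ℕ} (Δ : LatticeSimplex d)

/-- The coordinates of `(x, n)` in the basis of the vectors `(v_i, 1)`. -/
noncomputable def homCoord (n : ℕ) (x : Fin d → ℝ) (i : Fin (d + 1)) : ℝ :=
  (Δ.affineBasis.coord i).linear x + n * Δ.affineBasis.coord i 0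

theorem sum_homCoord (n : ℕ) (x : Fin d → ℝ) : ∑ i, Δ.homCoord n x i = n := by
  simp only [homCoord, coord_linear_eq, Finset.sum_add_distrib, Finset.sum_sub_distrib,
    ← Finset.mul_sum, AffineBasis.sum_coord_apply_eq_one]
  ring

theorem sum_homCoord_smul (n : ℕ) (x : Fin d → ℝ) :
    ∑ i, Δ.homCoord n x i • toReal (Δ.vertex i) = x := by
  simp only [homCoord, coord_linear_eq, Finset.sum_add_distrib, Finset.sum_sub_distrib, add_smul,
    sub_smul, mul_smul, ← Finset.smul_sum, sum_coord_smul, smul_zero, sub_zero, add_zero]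

theorem homCoord_eq {n : ℕ} {x : Fin d → ℝ} {a : Fin (d + 1) → ℝ} (ha : ∑ i, a i = n)
    (hx : ∑ i, a i • toReal (Δ.vertex i) = x) : Δ.homCoord n x = a := by
  funext i
  rw [homCoord, ← hx, map_sum]
  simp_rw [map_smul, coord_linear_eq, ← affineBasis_apply, AffineBasis.coord_apply, smul_eq_mul,
    mul_sub, Finset.sum_sub_distrib, ← Finset.sum_mul, ha]
  simp

theorem mem_smul_body_iff (n : ℕ) (x : Fin d → ℝ) :
    x ∈ (n : ℝ) • Δ.body ↔ ∀ i, 0 ≤ Δ.homCoord n x i := by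
  have hbody : Δ.body = {x | ∀ i, 0 ≤ Δ.affineBasis.coord i x} :=
    Δ.affineBasis.convexHull_eq_nonneg_coord
  rw [Set.mem_smul_set]
  constructor
  · rintro ⟨y, hy, rfl⟩ i
    rw [hbody] at hy
    rw [Δ.homCoord_eq (a := fun i => n * Δ.affineBasis.coord i y)]
    · exact mul_nonneg n.cast_nonneg (hy i)
    · rw [← Finset.mul_sum, AffineBasis.sum_coord_apply_eq_one, mul_one]
    · simp_rw [mul_smul, ← Finset.smul_sum, sum_coord_smul]
  · intro h
    -- For `n = 0` nonnegative coordinates with sum zero vanish, so `x = 0`; a vertex witnesses that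
    -- the body is nonempty.
    rcases Nat.eq_zero_or_pos n with rfl | hn
    · have h0 : ∀ i, Δ.homCoord 0 x i = 0 := fun i =>
        (Finset.sum_eq_zero_iff_of_nonneg fun i _ => h i).1
          (by simpa using Δ.sum_homCoord 0 x) i (Finset.mem_univ i)
      have hx := Δ.sum_homCoord_smul 0 x
      simp only [h0, zero_smul, Finset.sum_const_zero] at hx
      exact ⟨toReal (Δ.vertex 0), subset_convexHull ℝ _ ⟨0, rfl⟩, by simp [← hx]⟩
    · have hn' : (0 : ℝ) < n := by exact_mod_cast hn
      refine ⟨(n : ℝ)⁻¹ • x, ?_, smul_inv_smul₀ hn'.ne' x⟩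
      rw [hbody]
      intro i
      have h1 : Δ.affineBasis.coord i ((n : ℝ)⁻¹ • x) = (n : ℝ)⁻¹ * Δ.homCoord n x i := by
        have h2 := Δ.coord_linear_eq i ((n : ℝ)⁻¹ • x)
        rw [map_smul, smul_eq_mul] at h2
        rw [homCoord]
        field_simp
        field_simp at h2
        linarith
      rw [h1]
      exact mul_nonneg (by positivity) (h i)

theorem coe_homCoord_mem (n : ℕ) (z : Fin d → ℤ) :
    (fun i => (Δ.homCoord n (toReal z) i : UnitAddCircle)) ∈ associatedGroup Δ.vertex :=
  (coe_mem_associatedGroup_iff _ _).2 ⟨⟨z, Δ.sum_homCoord_smul n _⟩, n, by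
    rw [Δ.sum_homCoord, Int.cast_natCast]⟩

theorem toReal_injective : Function.Injective (toReal : (Fin d → ℤ) → Fin d → ℝ) :=
  fun a b h => funext fun j => by simpa [toReal] using congr_fun h j

theorem finite_lattice_points (n : ℕ) : {z : Fin d → ℤ | toReal z ∈ (n : ℝ) • Δ.body}.Finite := by
  let M : Fin d → ℤ := fun j => ∑ i, n * |Δ.vertex i j|
  refine (Set.finite_Icc (-M) M).subset fun z hz => ?_
  have hz' := (Δ.mem_smul_body_iff n _).1 hz
  have key : ∀ j, |z j| ≤ M j := fun j => by
    have h1 := congr_fun (Δ.sum_homCoord_smul n (toReal z)) j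
    simp only [Finset.sum_apply, Pi.smul_apply, smul_eq_mul] at h1
    have h2 : |(z j : ℝ)| ≤ ∑ i, n * |(Δ.vertex i j : ℝ)| := by
      rw [show (z j : ℝ) = toReal z j from rfl, ← h1]
      refine (Finset.abs_sum_le_sum_abs _ _).trans (Finset.sum_le_sum fun i _ => ?_)
      rw [abs_mul, abs_of_nonneg (hz' i)]
      refine mul_le_mul_of_nonneg_right ?_ (abs_nonneg _)
      rw [← Δ.sum_homCoord n (toReal z)]
      exact Finset.single_le_sum (fun i _ => hz' i) (Finset.mem_univ i)
    exact_mod_cast h2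
  exact ⟨fun j => (abs_le.1 (key j)).1, fun j => (abs_le.1 (key j)).2⟩

theorem exists_height (x : associatedGroup Δ.vertex) :
    ∃ h : ℕ, ∑ i, frac (x.1 i) = h := by
  have hx := x.2
  have h1 : (fun i => ((frac (x.1 i) : ℝ) : UnitAddCircle)) = x.1 := funext fun i => coe_frac _
  rw [← h1, coe_mem_associatedGroup_iff] at hx
  obtain ⟨-, m, hm⟩ := hx
  have h0 : 0 ≤ m := by
    have : (0 : ℝ) ≤ m := hm ▸ Finset.sum_nonneg fun i _ => frac_nonneg _
    exact_mod_cast this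
  lift m to ℕ using h0
  exact ⟨m, by simpa using hm⟩

/-- The height of an element of the associated group. -/
noncomputable def height (x : associatedGroup Δ.vertex) : ℕ := (Δ.exists_height x).choose

theorem sum_frac (x : associatedGroup Δ.vertex) : ∑ i, frac (x.1 i) = Δ.height x :=
  (Δ.exists_height x).choose_spec

/-- Coordinates with prescribed fractional and integral parts come from a lattice point. -/
theorem exists_lattice_point (x : associatedGroup Δ.vertex) (m : Fin (d + 1) → ℕ) :
    ∃ z : Fin d → ℤ, ∀ n : ℕ, Δ.height x + ∑ i, m i = n →
      Δ.homCoord n (toReal z) = fun i => frac (x.1 i) + m i := by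
  have h1 : (fun i => ((frac (x.1 i) + m i : ℝ) : UnitAddCircle)) = x.1 := funext fun i => by
    have hm : ((m i : ℝ) : UnitAddCircle) = 0 :=
      (coe_eq_zero_iff_exists_int _).2 ⟨m i, by simp⟩
    rw [AddCircle.coe_add, hm, coe_frac, add_zero]
  have hx := x.2
  rw [← h1, coe_mem_associatedGroup_iff] at hx
  obtain ⟨⟨z, hz⟩, -⟩ := hx
  refine ⟨z, fun n hn => Δ.homCoord_eq ?_ hz⟩
  rw [Finset.sum_add_distrib, sum_frac, ← hn]
  push_cast
  rfl

theorem height_le (x : associatedGroup Δ.vertex) : Δ.height x ≤ d + 1 := by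
  have h : (Δ.height x : ℝ) ≤ ∑ _i : Fin (d + 1), (1 : ℝ) := by
    rw [← sum_frac]
    exact Finset.sum_le_sum fun i _ => (frac_lt_one _).le
  simp only [Finset.sum_const, Finset.card_univ, Fintype.card_fin, nsmul_eq_mul, mul_one] at h
  exact_mod_cast h

/-- The representatives of a group element give a lattice point in the dilate by its height. Heights
are at most `d + 1`, and height and point together determine the element. -/
instance : Finite (associatedGroup Δ.vertex) := by
  choose z hz using fun x => Δ.exists_lattice_point x 0
  have hfin : (⋃ n ∈ Finset.range (d + 2),
      {z : Fin d → ℤ | toReal z ∈ (n : ℝ) • Δ.body}).Finite :=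
    Set.Finite.biUnion (Finset.finite_toSet _) fun n _ => Δ.finite_lattice_points n
  have hinj : Function.Injective fun x => (Δ.height x, z x) := fun x y hxy => by
    simp only [Prod.mk.injEq] at hxy
    have h1 := hz x _ (by simp; rfl)
    have h2 := hz y _ (by simp; rfl)
    rw [hxy.1, hxy.2, h2] at h1
    refine Subtype.ext (funext fun i => frac_injective ?_)
    simpa using (congr_fun h1 i).symm
  refine Set.finite_univ_iff.1 (Set.Finite.of_finite_image
    (((Finset.range (d + 2)).finite_toSet.prod hfin).subset ?_) hinj.injOn)
  rintro - ⟨x, -, rfl⟩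
  have hlt : Δ.height x < d + 2 := Nat.lt_succ_of_le (Δ.height_le x)
  refine ⟨by simpa using hlt, ?_⟩
  simp only [Set.mem_iUnion]
  refine ⟨Δ.height x, Finset.mem_range.2 hlt, (Δ.mem_smul_body_iff _ _).2 fun i => ?_⟩
  rw [hz x _ (by simp)]
  simpa using frac_nonneg (x.1 i)

/-- Fractional parts of the homogeneous coordinates give the group element, floors give a tuple of
naturals with sum `n` minus the height. -/
theorem ehrhartCount_eq [Fintype (associatedGroup Δ.vertex)] (n : ℕ) :
    ehrhartCount Δ.body n = ∑ x : associatedGroup Δ.vertex,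
      if Δ.height x ≤ n then (Finset.finsuppAntidiag (Finset.univ : Finset (Fin (d + 1)))
        (n - Δ.height x)).card else 0 := by
  classical
  let T : Finset (Σ _ : associatedGroup Δ.vertex, (Fin (d + 1) →₀ ℕ)) :=
    Finset.univ.sigma fun x => if Δ.height x ≤ n then
      Finset.finsuppAntidiag Finset.univ (n - Δ.height x) else ∅
  have hT : ∀ y, y ∈ T ↔ Δ.height y.1 + ∑ i, y.2 i = n := fun y => by
    simp only [T, Finset.mem_sigma, Finset.mem_univ, true_and]
    split_ifs with h
    · simp only [Finset.mem_finsuppAntidiag, Finset.subset_univ, and_true]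
      change (∑ i, y.2 i) = _ ↔ _
      omega
    · simp only [Finset.notMem_empty, false_iff]
      omega
  have hTcard : T.card = ∑ x : associatedGroup Δ.vertex,
      if Δ.height x ≤ n then (Finset.finsuppAntidiag (Finset.univ : Finset (Fin (d + 1)))
        (n - Δ.height x)).card else 0 := by
    rw [Finset.card_sigma]
    refine Finset.sum_congr rfl fun x _ => ?_
    split_ifs <;> simp
  rw [← hTcard, ehrhartCount, ← Set.ncard_coe_finset]
  have hsplit : ∀ z : Fin d → ℤ, toReal z ∈ (n : ℝ) • Δ.body → ∀ i,
      frac (Δ.homCoord n (toReal z) i : UnitAddCircle) + ⌊Δ.homCoord n (toReal z) i⌋₊ =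
        Δ.homCoord n (toReal z) i := fun z hz i => by
    rw [frac_coe, natCast_floor_eq_intCast_floor ((Δ.mem_smul_body_iff n _).1 hz i)]
    exact Int.fract_add_floor _
  refine Set.ncard_congr (fun z _ => ⟨⟨_, Δ.coe_homCoord_mem n z⟩,
    Finsupp.equivFunOnFinite.symm fun i => ⌊Δ.homCoord n (toReal z) i⌋₊⟩) ?_ ?_ ?_
  · intro z hz
    rw [Finset.mem_coe, hT]
    have h : ((Δ.height ⟨_, Δ.coe_homCoord_mem n z⟩ : ℕ) : ℝ) +
        ∑ i, (⌊Δ.homCoord n (toReal z) i⌋₊ : ℝ) = n := by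
      rw [← sum_frac, ← Finset.sum_add_distrib, ← Δ.sum_homCoord n (toReal z)]
      exact Finset.sum_congr rfl fun i _ => hsplit z hz i
    simp only [Finsupp.equivFunOnFinite_symm_apply_apply]
    exact_mod_cast h
  · intro z z' hz hz' heq
    rw [Sigma.mk.injEq, Subtype.mk.injEq, heq_eq_eq] at heq
    have hc : Δ.homCoord n (toReal z) = Δ.homCoord n (toReal z') := funext fun i => by
      have h1 := congr_fun heq.1 i
      have h2 := congr_fun (Finsupp.equivFunOnFinite.symm.injective heq.2) i
      rw [← hsplit z hz i, ← hsplit z' hz' i, h1, h2]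
    apply toReal_injective
    rw [← Δ.sum_homCoord_smul n (toReal z), ← Δ.sum_homCoord_smul n (toReal z'), hc]
  · rintro ⟨x, m⟩ hy
    rw [Finset.mem_coe, hT] at hy
    obtain ⟨z, hz⟩ := Δ.exists_lattice_point x m
    have hz' := hz n hy
    refine ⟨z, (Δ.mem_smul_body_iff n _).2 fun i => ?_, ?_⟩
    · rw [hz']
      exact add_nonneg (frac_nonneg _) (Nat.cast_nonneg _)
    · refine Sigma.ext (Subtype.ext (funext fun i => ?_)) (heq_of_eq (Finsupp.ext fun i => ?_))
      · dsimp only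
        have hm : ((m i : ℝ) : UnitAddCircle) = 0 :=
          (coe_eq_zero_iff_exists_int _).2 ⟨m i, by simp⟩
        rw [hz', AddCircle.coe_add, hm, coe_frac, add_zero]
      · rw [Finsupp.equivFunOnFinite_symm_apply_apply, hz', Nat.floor_add_natCast (frac_nonneg _),
          Nat.floor_eq_zero.2 (frac_lt_one _), zero_add]

/-- The `δ`-polynomial of a simplex enumerates the heights of the elements of the associated
group. -/
theorem deltaSeries_eq [Fintype (associatedGroup Δ.vertex)] : deltaSeries Δ.body =
    ∑ x : associatedGroup Δ.vertex, (PowerSeries.X : PowerSeries ℤ) ^ Δ.height x := by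
  -- The coefficients of `(1 - X)⁻¹ ^ (d + 1)` count the tuples of naturals with given sum.
  have hpow : ∀ r, PowerSeries.coeff r ((PowerSeries.mk 1 : PowerSeries ℤ) ^ (d + 1)) =
      (Finset.finsuppAntidiag (Finset.univ : Finset (Fin (d + 1))) r).card := fun r => by
    have h := PowerSeries.coeff_prod (fun _ : Fin (d + 1) => (PowerSeries.mk 1 : PowerSeries ℤ)) r
      Finset.univ
    rw [Finset.prod_const, Finset.card_univ, Fintype.card_fin] at h
    rw [h]
    simp
  have hmk : (PowerSeries.mk fun n => (ehrhartCount Δ.body n : ℤ)) =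
      (PowerSeries.mk 1 : PowerSeries ℤ) ^ (d + 1) *
        ∑ x : associatedGroup Δ.vertex, (PowerSeries.X : PowerSeries ℤ) ^ Δ.height x := by
    ext n
    rw [PowerSeries.coeff_mk, ehrhartCount_eq, Finset.mul_sum, map_sum]
    push_cast
    refine Finset.sum_congr rfl fun x _ => ?_
    rw [PowerSeries.coeff_mul_X_pow', hpow]
  rw [deltaSeries, hmk, ← mul_assoc, ← mul_pow, mul_comm (1 - _),
    PowerSeries.mk_one_mul_one_sub_eq_one, one_pow, one_mul]

/-- The characters of the associated group given by the coordinates. -/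
def coordChar (i : Fin (d + 1)) : associatedGroup Δ.vertex →+ UnitAddCircle :=
  (Pi.evalAddMonoidHom _ i).comp (associatedGroup Δ.vertex).subtype

/-- Coefficients are compared degree by degree; since `k + 1 > 0`, distinct `j` give distinct
degrees, so each height occurs once. -/
theorem exists_ranking {N k : ℕ} (hδ : deltaSeries Δ.body =
      ∑ j ∈ Finset.range N, (PowerSeries.X : PowerSeries ℤ) ^ (j * (k + 1))) :
    Nat.card (associatedGroup Δ.vertex) = N ∧
      ∃ rk, IsHeightRanking Δ.coordChar (fun _ => 1) ((k : ℝ) + 1) rk := by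
  classical
  have := Fintype.ofFinite (associatedGroup Δ.vertex)
  have hcount : ∀ n, (Finset.univ.filter fun x => n = Δ.height x).card =
      ((Finset.range N).filter fun j => n = j * (k + 1)).card := fun n => by
    rw [deltaSeries_eq] at hδ
    have h := congr_arg (PowerSeries.coeff n) hδ
    simp only [map_sum, PowerSeries.coeff_X_pow, Finset.sum_boole] at h
    exact_mod_cast h
  have hrk : ∀ x, ∃ j < N, Δ.height x = j * (k + 1) := fun x => by
    have h : 0 < ((Finset.range N).filter fun j => Δ.height x = j * (k + 1)).card := by
      rw [← hcount]
      exact Finset.card_pos.2 ⟨x, by simp⟩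
    obtain ⟨j, hj⟩ := Finset.card_pos.1 h
    rw [Finset.mem_filter, Finset.mem_range] at hj
    exact ⟨j, hj⟩
  choose rk hlt hrk using hrk
  have hinj : Function.Injective rk := fun x y hxy => by
    have h : ((Finset.range N).filter fun j => Δ.height x = j * (k + 1)).card ≤ 1 := by
      rw [Finset.card_le_one]
      intro a ha b hb
      rw [Finset.mem_filter] at ha hb
      exact Nat.eq_of_mul_eq_mul_right k.succ_pos (ha.2.symm.trans hb.2)
    rw [← hcount, Finset.card_le_one] at h
    exact h x (by simp) y (by simp [hrk, hxy])
  have hsurj : ∀ j < N, ∃ x, rk x = j := fun j hj => by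
    have h : 0 < (Finset.univ.filter fun x => j * (k + 1) = Δ.height x).card := by
      rw [hcount]
      exact Finset.card_pos.2 ⟨j, by simpa using hj⟩
    obtain ⟨x, hx⟩ := Finset.card_pos.1 h
    rw [Finset.mem_filter, hrk] at hx
    exact ⟨x, (Nat.eq_of_mul_eq_mul_right k.succ_pos hx.2).symm⟩
  have hcard : Nat.card (associatedGroup Δ.vertex) = N := by
    rw [← Nat.card_fin N]
    refine Nat.card_eq_of_bijective (fun x => (⟨rk x, hlt x⟩ : Fin N))
      ⟨fun x y h => hinj (by simpa using h), fun j => ?_⟩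
    obtain ⟨x, hx⟩ := hsurj j j.2
    exact ⟨x, Fin.ext hx⟩
  refine ⟨hcard, rk, ⟨fun _ => one_pos, by positivity, fun x => ?_, hinj, fun x => ?_⟩⟩
  · have h := Δ.sum_frac x
    rw [hrk] at h
    push_cast at h
    rw [mul_comm, ← h]
    simp [coordChar]
  · rw [hcard]; exact hlt x

end LatticeSimplex

/-! ### Reordering the vertices and conclusion -/

theorem mem_associatedGroup_comp_equiv {ι κ : Type*} [Fintype ι] [Fintype κ] {d : ℕ}
    (v : ι → Fin d → ℤ) (σ : κ ≃ ι) (x : ι → UnitAddCircle) :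
    (fun y => x (σ y)) ∈ associatedGroup (fun y => v (σ y)) ↔ x ∈ associatedGroup v := by
  refine and_congr (forall_congr' fun j => ?_) ?_
  · rw [← σ.sum_comp]
  · rw [← σ.sum_comp]

end GorensteinSimplex

open GorensteinSimplex in
theorem corollary4p2 (p ℓ k d : ℕ) (hp : p.Prime) (hℓ : 0 < ℓ)
    (Δ : GorensteinSimplex.LatticeSimplex d)
    (hcyc : IsAddCyclic (GorensteinSimplex.associatedGroup Δ.vertex))
    (hδ : GorensteinSimplex.deltaSeries Δ.body =
      ∑ j ∈ Finset.range (p ^ ℓ), (PowerSeries.X : PowerSeries ℤ) ^ (j * (k + 1)))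
    (hpyr : ¬ GorensteinSimplex.IsLatticePyramid d Δ.body) :
    ∃ (t : ℕ) (e s : ℕ → ℕ), 1 ≤ t ∧ e 0 = 0 ∧ StrictMonoOn e (Set.Iic t) ∧ e t = ℓ ∧
      (∀ i, 1 ≤ i → i ≤ t → 0 < s i) ∧
      (∀ i, 1 ≤ i → i < t →
        (s i : ℤ) = ((p : ℤ) ^ (ℓ - e (i - 1)) - (p : ℤ) ^ (ℓ - e (i + 1))) * ((k : ℤ) + 1)) ∧
      s t = p ^ (ℓ - e (t - 1)) * (k + 1) ∧
      ∃ σ : ((i : Finset.Icc 1 t) × Fin (s i)) ≃ Fin (d + 1),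
        GorensteinSimplex.associatedGroup (fun x => Δ.vertex (σ x)) =
          AddSubgroup.zmultiples
            (fun x => (((1 : ℝ) / (p : ℝ) ^ e x.1 : ℝ) : UnitAddCircle)) := by
  classical
  obtain ⟨hcard, rk, H⟩ := Δ.exists_ranking hδ
  obtain ⟨t, e, idx, g, he0, hmono, het, hidx, hgen, hχ, hsum, hsumt⟩ :=
    H.exists_generator hp ℓ hcard
  have hg : ∀ i, g.1 i = (((1 : ℝ) / (p : ℝ) ^ e (idx i) : ℝ) : UnitAddCircle) := hχ
  have hp1 : (1 : ℝ) < p := by exact_mod_cast hp.one_lt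
  have ht : 1 ≤ t := by
    rcases Nat.eq_zero_or_pos t with rfl | h
    · omega
    · exact h
  -- In block zero the generator has coordinate `1 / p ^ 0 = 0` in the circle, so the coordinate
  -- vanishes on the whole group.
  have hidx1 : ∀ i, 1 ≤ idx i := fun i => by
    by_contra hcon
    have h0 : g.1 i = 0 := by
      rw [hg i, show idx i = 0 by omega, he0, pow_zero, div_one]
      exact AddCircle.coe_period 1
    have hzero : ∀ x ∈ associatedGroup Δ.vertex, x i = 0 := fun x hx => by
      obtain ⟨m, hm⟩ := AddSubgroup.mem_zmultiples_iff.1 (hgen ⟨x, hx⟩)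
      have h1 : x = m • g.1 := (congr_arg Subtype.val hm).symm
      rw [h1, Pi.smul_apply, h0, smul_zero]
    -- A point is never a pyramid; for `d = 0` the group would be trivial, against `0 < ℓ`.
    cases d with
    | zero =>
      have hone : Nat.card (associatedGroup Δ.vertex) = 1 := by
        rw [Nat.card_eq_one_iff_unique]
        refine ⟨⟨fun x y => Subtype.ext (funext fun j => ?_)⟩, ⟨0⟩⟩
        rw [show j = i by omega, hzero _ x.2, hzero _ y.2]
      rw [hcard] at hone
      exact (Nat.one_lt_pow hℓ.ne' hp.one_lt).ne' hone
    | succ d => exact hpyr (isLatticePyramid_of_forall_apply_eq_zero Δ i hzero)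
  simp only [Finset.sum_const, nsmul_eq_mul, mul_one] at hsum hsumt
  let s : ℕ → ℕ := fun j => (Finset.univ.filter fun i => idx i = j).card
  have hk : (0 : ℝ) < (k : ℝ) + 1 := by positivity
  refine ⟨t, e, s, ht, he0, hmono, het, fun j hj hjt => ?_, fun j hj hjt => ?_, ?_, ?_⟩
  · have : (0 : ℝ) < s j := by
      rcases hjt.lt_or_eq with hlt | rfl
      · have h1 : e (j - 1) < e (j + 1) :=
          hmono (Set.mem_Iic.2 (by omega)) (Set.mem_Iic.2 (by omega)) (by omega)
        have h2 : e (j + 1) ≤ e t := hmono.monotoneOn (Set.mem_Iic.2 (by omega))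
          (Set.mem_Iic.2 le_rfl) (by omega)
        have h3 := pow_lt_pow_right₀ hp1 (by omega : ℓ - e (j + 1) < ℓ - e (j - 1))
        rw [hsum j hj hlt]
        exact mul_pos hk (by linarith)
      · rw [hsumt hj]
        positivity
    exact_mod_cast this
  · have h := hsum j hj hjt
    rw [mul_comm] at h
    exact_mod_cast h
  · have h := hsumt ht
    rw [mul_comm] at h
    exact_mod_cast h
  · let f : Fin (d + 1) → Finset.Icc 1 t := fun i =>
      ⟨idx i, Finset.mem_Icc.2 ⟨hidx1 i, hidx i⟩⟩
    have hcardf : ∀ j : Finset.Icc 1 t, Fintype.card {i // f i = j} = Fintype.card (Fin (s j)) :=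
      fun j => by
        rw [Fintype.card_fin, Fintype.card_subtype]
        simp only [s, f, Subtype.ext_iff]
    -- Vertices are listed block by block, through the fibres of `idx`.
    let σ : ((j : Finset.Icc 1 t) × Fin (s j)) ≃ Fin (d + 1) :=
      (Equiv.sigmaCongrRight fun j => (Fintype.equivOfCardEq (hcardf j)).symm).trans
        (Equiv.sigmaFiberEquiv f)
    have hσ : ∀ y, idx (σ y) = y.1 := fun y =>
      congr_arg Subtype.val ((Fintype.equivOfCardEq (hcardf y.1)).symm y.2).2
    refine ⟨σ, ?_⟩
    have hgσ : (fun y : (j : Finset.Icc 1 t) × Fin (s j) =>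
        (((1 : ℝ) / (p : ℝ) ^ e y.1 : ℝ) : UnitAddCircle)) = fun y => g.1 (σ y) :=
      funext fun y => by rw [hg, hσ]
    rw [hgσ]
    apply le_antisymm
    · intro x hx
      have hx' : (fun i => x (σ.symm i)) ∈ associatedGroup Δ.vertex := by
        rw [← mem_associatedGroup_comp_equiv Δ.vertex σ]
        simpa using hx
      obtain ⟨m, hm⟩ := AddSubgroup.mem_zmultiples_iff.1 (hgen ⟨_, hx'⟩)
      refine AddSubgroup.mem_zmultiples_iff.2 ⟨m, funext fun y => ?_⟩
      have h1 : m • g.1 = fun i => x (σ.symm i) := congr_arg Subtype.val hm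
      have h2 := congr_fun h1 (σ y)
      rw [Equiv.symm_apply_apply] at h2
      exact h2
    · rw [AddSubgroup.zmultiples_le]
      exact (mem_associatedGroup_comp_equiv Δ.vertex σ g.1).2 g.2
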